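/- **Setting.** A simplicial complex is a finite family $\Delta$ of finite sets of integers (its faces) that contains $\emptyset$ and is closed under passing to subsets; $\Delta_i$ is the set of faces of dimension $i$ (that is, with $i+1$ elements), and $d=\dim\Delta\ge -1$ is the largest dimension of a face. For finite sets of integers $A=\{a_1<\dots<a_m\}$ and $B=\{b_1<\dots<b_n\}$ write $A\preceq B$ if $m=n$ and $a_j\le b_j$ for all $j$. The complex $\Delta$ is shifted if there are integers $p,q$ such that every face is contained in $[p,q]=\{p,\dots,q\}$ and, whenever $B\in\Delta$, $A\subseteq[p,q]$ and $A\preceq B$, also $A\in\Delta$. Let $\Bbbk$ be the field of rational functions in indeterminates $x_{i,j}$ ($i,j\in\mathbb Z$) over a field of characteristic zero, and let $\uparrow$ be the field endomorphism of $\Bbbk$ that fixes the coefficients and sends $x_{i,j}$ to $x_{i+1,j}$. For a multiset of integers $S=\{s_1\le\dots\le s_m\}$ put $x_S=x_{1,s_1}x_{2,s_2}\cdots x_{m,s_m}$ and $X_S=x_S^2$. Put $\varepsilon(j,F)=(-1)^{t+1}$ if $j$ is the $t$-th smallest element of $F$. Let $C_i(\Delta)$ be the $\Bbbk$-vector space with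 basis $\{[F]:F\in\Delta_i\}$. The algebraic finely weighted boundary map $\partial_i:C_i(\Delta)\to C_{i-1}(\Delta)$ and coboundary map $\partial_i^*:C_{i-1}(\Delta)\to C_i(\Delta)$ are $$\partial_i[F]=\sum_{j\in F}\varepsilon(j,F)\,\frac{\uparrow^{d-i}(x_F)}{\uparrow^{d-i+1}(x_{F\setminus j})}\,[F\setminus j],\qquad \partial_i^*[F]=\sum_{j\notin F,\ F\cup j\in\Delta}\varepsilon(j,F\cup j)\,\frac{\uparrow^{d-i}(x_{F\cup j})}{\uparrow^{d-i+1}(x_F)}\,[F\cup j].$$ Let $\mathrm{Spec}^{ud}_{i-1}(\Delta)$ be the multiset of eigenvalues (in an algebraic closure of $\Bbbk$, with multiplicity) of $\partial_i\partial_i^*$ acting on $C_{i-1}(\Delta)$. For a finite family $\mathcal F$ of finite sets of integers, a critical pair is a pair $(A,B)$ with $A\in\mathcal F$, $B\notin\mathcal F$ and $B=(A\setminus\{a\})\cup\{a+1\}$ for some $a\in A$ with $a+1\notin A$. Its long signature is $(S,T)$ with $S=\{v\in A: v<a\}$ and $T=[p,a]$, where $p$ is the smallest integer occurring in a member of $\mathcal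 F$. For multisets of integers $S,T$, the $z$-polynomial is $$z(S,T)=\frac{1}{\uparrow X_S}\sum_{j\in T}X_{S\cup j},$$ with $\cup$ denoting multiset union. **Corollary.** 1. A shifted complex is completely determined by its spectra: if $\Delta$ and $\Gamma$ are shifted complexes and the families $\{\mathrm{Spec}^{ud}_{i-1}(\Delta)\}_{i=0}^{\dim\Delta}$ and $\{\mathrm{Spec}^{ud}_{i-1}(\Gamma)\}_{i=0}^{\dim\Gamma}$ are equal (as finite sequences, so in particular of the same length), then $\Delta=\Gamma$. 2. A long signature can be read off from its $z$-polynomial: if $(S,T)$ and $(S',T')$ are long signatures of critical pairs of finite families $\mathcal F$ and $\mathcal G$ of finite sets of integers, and $z(S,T)=z(S',T')$, then $S=S'$ and $T=T'$. 3. The long signatures recover all $\preceq$-maximal faces: if $F$ is a nonempty $\preceq$-maximal face of a shifted complex $\Delta$ and $i=\dim F$, then $F=S\cup\{\max T\}$ for the long signature $(S,T)$ of some critical pair of $\Delta_i$. 4. Hence they recover all nonempty faces: a nonempty finite set $G$ of integers is a face of a shifted complex $\Delta$ if and only if, for some $i$, some long signature $(S,T)$ of a critical pair of $\Delta_i$ satisfies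 $G\subseteq T$ and $G\preceq S\cup\{\max T\}$. -/

import Mathlib

namespace FineShifted

noncomputable section

/-- A finite simplicial complex whose vertices are integers: a finite family of finite sets of
integers that contains the empty set and is closed under passing to subsets. -/
@[ext]
structure SimpComplex where
  faces : Finset (Finset ℤ)
  empty_mem : ∅ ∈ faces
  down_closed : ∀ F ∈ faces, ∀ G ⊆ F, G ∈ faces

/-- The componentwise partial order on finite sets of integers:
`{a₁ < ⋯ < aₘ} ⪯ {b₁ < ⋯ < bₙ}` iff `m = n` and `aⱼ ≤ bⱼ` for all `j`. -/
def CompLE (A B : Finset ℤ) : Prop :=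
  List.Forall₂ (fun a b : ℤ => a ≤ b) (A.sort (· ≤ ·)) (B.sort (· ≤ ·))

/-- `Δ.level k` is the set of faces with exactly `k` elements, that is, of dimension `k - 1`. -/
def SimpComplex.level (Δ : SimpComplex) (k : ℕ) : Finset (Finset ℤ) :=
  Δ.faces.filter fun F => F.card = k

/-- `Δ.size = d + 1`, where `d = dim Δ` (so `d = -1` if the empty set is the only face). -/
def SimpComplex.size (Δ : SimpComplex) : ℕ := Δ.faces.sup Finset.card

/-- `Δ` is shifted: for some integer interval `[p, q]` it is a complex on the vertex set `[p, q]`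
whose faces form an order ideal for the componentwise order on subsets of `[p, q]`. -/
def SimpComplex.IsShifted (Δ : SimpComplex) : Prop :=
  ∃ p q : ℤ, (∀ F ∈ Δ.faces, F ⊆ Finset.Icc p q) ∧
    ∀ A B : Finset ℤ, B ∈ Δ.faces → A ⊆ Finset.Icc p q → CompLE A B → A ∈ Δ.faces

section Weights

/-- The field of rational functions over `𝕜` in indeterminates `x_{i,j}`, with `i`, `j` integers. -/
abbrev RatField (𝕜 : Type*) [Field 𝕜] : Type _ := FractionRing (MvPolynomial (ℤ × ℤ) 𝕜)

variable (𝕜 : Type*) [Field 𝕜]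

/-- The indeterminate `x_{i,j}`. -/
def indet (i j : ℤ) : RatField 𝕜 :=
  algebraMap (MvPolynomial (ℤ × ℤ) 𝕜) (RatField 𝕜) (MvPolynomial.X (i, j))

theorem succ_fst_injective :
    Function.Injective (fun ij : ℤ × ℤ => ((ij.1 + 1, ij.2) : ℤ × ℤ)) := by
  rintro ⟨a, b⟩ ⟨c, d⟩ h
  simpa using h

theorem rename_succ_injective :
    Function.Injective ((MvPolynomial.rename (R := 𝕜)
      (fun ij : ℤ × ℤ => ((ij.1 + 1, ij.2) : ℤ × ℤ))).toRingHom :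
        MvPolynomial (ℤ × ℤ) 𝕜 →+* MvPolynomial (ℤ × ℤ) 𝕜) :=
  MvPolynomial.rename_injective _ succ_fst_injective

/-- The raising operator: the field endomorphism over `𝕜` with `x_{i,j} ↦ x_{i+1,j}`. -/
def raise : RatField 𝕜 →+* RatField 𝕜 :=
  IsFractionRing.map (rename_succ_injective 𝕜)

theorem raise_indet (i j : ℤ) : raise 𝕜 (indet 𝕜 i j) = indet 𝕜 (i + 1) j := by
  unfold raise indet IsFractionRing.map
  rw [IsLocalization.map_eq]
  simp

/-- `x_S = x_{1,i₁} x_{2,i₂} ⋯ x_{m,iₘ}` for a multiset `S = {i₁ ≤ i₂ ≤ ⋯ ≤ iₘ}`. -/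
def monomialx (S : Multiset ℤ) : RatField 𝕜 :=
  ((S.sort (· ≤ ·)).mapIdx fun k v => indet 𝕜 ((k : ℤ) + 1) v).prod

/-- `X_S = x_S²`. -/
def monomialX (S : Multiset ℤ) : RatField 𝕜 := monomialx 𝕜 S ^ 2

/-- `ε(v, F) = (-1)^(j+1)` if `v` is the `j`-th smallest element of `F`, and `0` if `v ∉ F`. -/
def sgn (v : ℤ) (F : Finset ℤ) : RatField 𝕜 :=
  if v ∈ F then (-1) ^ (F.filter fun u => u < v).card else 0

/-- The algebraic finely weighted boundary map from chains on faces of dimension `k` (`k + 1`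
elements) to chains on faces of dimension `k - 1` (`k` elements), as a matrix; column `F` holds
`∑_{j ∈ F} ε(j, F) ↑^(d-k)(x_F) / ↑^(d-k+1)(x_{F ∖ j}) [F ∖ j]`, where `d - k = size - (k + 1)`. -/
def boundary (Δ : SimpComplex) (k : ℕ) : Matrix (Δ.level k) (Δ.level (k + 1)) (RatField 𝕜) :=
  fun G F => ∑ j ∈ F.1, if F.1.erase j = G.1 then
    sgn 𝕜 j F.1 * ((raise 𝕜)^[Δ.size - (k + 1)] (monomialx 𝕜 F.1.val) /
      (raise 𝕜)^[Δ.size - (k + 1) + 1] (monomialx 𝕜 (F.1.erase j).val)) else 0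

/-- The algebraic finely weighted coboundary map from chains on faces of dimension `k - 1`
to chains on faces of dimension `k`, as a matrix; column `F` holds
`∑_{j ∉ F, F ∪ j ∈ Δ} ε(j, F ∪ j) ↑^(d-k)(x_{F ∪ j}) / ↑^(d-k+1)(x_F) [F ∪ j]`. -/
def coboundary (Δ : SimpComplex) (k : ℕ) : Matrix (Δ.level (k + 1)) (Δ.level k) (RatField 𝕜) :=
  fun H F => ∑ j ∈ H.1 \ F.1, if insert j F.1 = H.1 then
    sgn 𝕜 j (insert j F.1) *
      ((raise 𝕜)^[Δ.size - (k + 1)] (monomialx 𝕜 (insert j F.1).val) /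
        (raise 𝕜)^[Δ.size - (k + 1) + 1] (monomialx 𝕜 F.1.val)) else 0

/-- The algebraic finely weighted up-down Laplacian on chains on faces of dimension `k - 1`:
first the coboundary, then the boundary. -/
def upDownLaplacian (Δ : SimpComplex) (k : ℕ) : Matrix (Δ.level k) (Δ.level k) (RatField 𝕜) :=
  boundary 𝕜 Δ k * coboundary 𝕜 Δ k

/-- The spectrum of the up-down Laplacian on chains on faces of dimension `i - 1`: the multiset of
its eigenvalues (roots of the characteristic polynomial in an algebraic closure, with
multiplicity). -/
def spec (Δ : SimpComplex) (i : ℕ) : Multiset (AlgebraicClosure (RatField 𝕜)) :=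
  (upDownLaplacian 𝕜 Δ i).charpoly.aroots (AlgebraicClosure (RatField 𝕜))

/-- The family of spectra in dimensions `i - 1`, for `i = 0, …, d`, as a list of length `d + 1`. -/
def spectra (Δ : SimpComplex) : List (Multiset (AlgebraicClosure (RatField 𝕜))) :=
  (List.range Δ.size).map fun i => spec 𝕜 Δ i

/-- The `z`-polynomial `z(S, T) = (1 / ↑X_S) ∑_{j ∈ T} X_{S ∪ j}`, with multiset union. -/
def zPoly (S T : Multiset ℤ) : RatField 𝕜 :=
  1 / raise 𝕜 (monomialX 𝕜 S) * (T.map fun j => monomialX 𝕜 (j ::ₘ S)).sum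

end Weights

/-- `B` covers `A` in the componentwise order: one element `a` of `A` is replaced by `a + 1`,
which was not in `A`. -/
def Covers (A B : Finset ℤ) : Prop :=
  ∃ a ∈ A, a + 1 ∉ A ∧ B = insert (a + 1) (A.erase a)

/-- `(A, B)` is a critical pair for the family `𝓕`. -/
def IsCriticalPair (𝓕 : Finset (Finset ℤ)) (A B : Finset ℤ) : Prop :=
  A ∈ 𝓕 ∧ B ∉ 𝓕 ∧ Covers A B

/-- The smallest integer occurring in a member of `𝓕` (with value `0` if there is none). -/
def initialVertex (𝓕 : Finset (Finset ℤ)) : ℤ := (𝓕.biUnion id).min.untopD 0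

/-- `(S, T)` is the long signature of a critical pair `(A, B)` for `𝓕`: if `B` arises from `A` by
replacing `a` by `a + 1`, then `S = {v ∈ A : v < a}` and `T = [p, a]`, where `p` is the smallest
integer occurring in a member of `𝓕`. -/
def IsLongSignature (𝓕 : Finset (Finset ℤ)) (S T : Finset ℤ) : Prop :=
  ∃ A B : Finset ℤ, IsCriticalPair 𝓕 A B ∧ ∃ a ∈ A \ B,
    S = A.filter (fun v => v < a) ∧ T = Finset.Icc (initialVertex 𝓕) a

end

end FineShifted

/-!
The quotient `X_{S ∪ j} / ↑X_S` only depends on `P = {v ∈ S : v < j}`, because the factors of the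
elements of `S` that are at least `j` cancel, and it is a Laurent monomial from which `P ∪ j` can
be read off. Since distinct Laurent monomials are linearly independent, `z(S, T)` determines the
sets `{v ∈ S : v < j} ∪ j` with `j ∈ T`, hence `T` and, when `max T` exceeds all of `S`, also `S`.

The coboundary map is the transpose of the boundary map, so the trace of `∂ᵢ ∂ᵢ*`, which is the sum
of its spectrum, is the sum of the squares of the entries of `∂ᵢ`, that is, `↑^(d-i)` applied to
the sum of `z(F, F)` over `F ∈ Δᵢ`. A set `G` with `i + 1 ≥ 1` elements occurs among the
initial segments of the faces `F ∈ Δᵢ` if and only if `G ∈ Δᵢ`, and then exactly once. Therefore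
the trace determines `Δᵢ`.

A `⪯`-maximal nonempty face leaves the complex when its largest vertex is raised by one. This gives
a critical pair whose long signature `(S, T)` satisfies `F = S ∪ {max T}`.
-/

namespace FineShifted

noncomputable section

open Finset MvPolynomial

theorem linearIndependent_algebraMap_monomial_div {σ ι R K : Type*} [CommRing R] [Field K]
    [Algebra (MvPolynomial σ R) K] [IsFractionRing (MvPolynomial σ R) K] [Algebra R K]
    [IsScalarTower R (MvPolynomial σ R) K] {a b : ι → σ →₀ ℕ}
    (hab : ∀ i j, a i + b j = a j + b i → i = j) :
    LinearIndependent R fun i =>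
      algebraMap (MvPolynomial σ R) K (monomial (a i) 1) /
        algebraMap (MvPolynomial σ R) K (monomial (b i) 1) := by
  have : Nontrivial R := (algebraMap R K).domain_nontrivial
  let φ := algebraMap (MvPolynomial σ R) K
  have φ_injective : Function.Injective φ := IsFractionRing.injective (MvPolynomial σ R) K
  refine linearIndependent_iff_finset_linearIndependent.2 fun s => ?_
  -- Multiplication by the common denominator turns the family into distinct monomials.
  set D := ∑ i ∈ s, b i
  have le_D (i : s) : b i ≤ D := single_le_sum_of_canonicallyOrdered i.2
  have exponent_injective : Function.Injective fun i : s => a i + (D - b i) := fun i j h => by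
    refine Subtype.ext (hab i j (Finsupp.ext fun x => ?_))
    have := DFunLike.congr_fun h x
    have := le_D i x
    have := le_D j x
    simp only [Finsupp.add_apply, Finsupp.tsub_apply] at *
    omega
  have mul_denominator (i : s) : φ (monomial D 1) * (φ (monomial (a i) 1) / φ (monomial (b i) 1)) =
      φ (monomial (a i + (D - b i)) 1) := by
    have denominator_ne_zero : φ (monomial (b i) 1) ≠ 0 :=
      (map_ne_zero_iff _ φ_injective).2 (monomial_eq_zero.not.2 one_ne_zero)
    rw [← mul_div_assoc, div_eq_iff denominator_ne_zero, ← map_mul, ← map_mul, monomial_mul,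
      monomial_mul, add_assoc, tsub_add_cancel_of_le (le_D i), add_comm]
  have numerators_independent :
      LinearIndependent R fun i : s => φ (monomial (a i + (D - b i)) 1) :=
    ((basisMonomials σ R).linearIndependent.comp _ exponent_injective).map_injOn
      (IsScalarTower.toAlgHom R (MvPolynomial σ R) K).toLinearMap φ_injective.injOn
  rw [← funext mul_denominator] at numerators_independent
  exact numerators_independent.of_comp (LinearMap.mulLeft R (φ (monomial D 1)))

theorem sort_add_of_forall_le {α : Type*} [LinearOrder α] {s t : Multiset α}
    (h : ∀ a ∈ s, ∀ b ∈ t, a ≤ b) :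
    (s + t).sort (· ≤ ·) = s.sort (· ≤ ·) ++ t.sort (· ≤ ·) := by
  refine List.Perm.eq_of_pairwise' (r := (· ≤ ·)) (Multiset.pairwise_sort ..) ?_ ?_
  · simpa [List.pairwise_append, Multiset.pairwise_sort] using h
  · simp [← Multiset.coe_eq_coe, ← Multiset.coe_add]

section Monomials

variable (𝕜 : Type*) [Field 𝕜]

theorem indet_ne_zero (i j : ℤ) : indet 𝕜 i j ≠ 0 :=
  (map_ne_zero_iff _ (IsFractionRing.injective _ _)).2 (X_ne_zero _)

theorem iterate_raise_indet (n : ℕ) (i j : ℤ) :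
    (raise 𝕜)^[n] (indet 𝕜 i j) = indet 𝕜 (i + n) j := by
  induction n generalizing i with
  | zero => simp
  | succ n ih =>
    rw [Function.iterate_succ_apply, raise_indet, ih]
    congr 1
    push_cast
    ring

theorem monomialx_ne_zero (S : Multiset ℤ) : monomialx 𝕜 S ≠ 0 := by
  simp [monomialx, List.prod_eq_zero_iff, List.mem_mapIdx, indet_ne_zero]

theorem monomialx_singleton (j : ℤ) : monomialx 𝕜 {j} = indet 𝕜 1 j := by
  simp [monomialx]

theorem monomialx_add {S T : Multiset ℤ} (h : ∀ a ∈ S, ∀ b ∈ T, a ≤ b) :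
    monomialx 𝕜 (S + T) = monomialx 𝕜 S * (raise 𝕜)^[S.card] (monomialx 𝕜 T) := by
  have raise_factor (k : ℕ) (v : ℤ) : indet 𝕜 ((k + S.card : ℕ) + 1) v =
      (raise 𝕜 ^ S.card) (indet 𝕜 (k + 1) v) := by
    rw [RingHom.coe_pow, iterate_raise_indet]
    congr 1
    push_cast
    ring
  simp only [monomialx, sort_add_of_forall_le h, List.mapIdx_append, List.prod_append,
    Multiset.length_sort, raise_factor]
  rw [← RingHom.coe_pow, map_list_prod]
  congr 2
  exact List.ext_getElem (by simp) (by simp)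

/-- The position of `v` in `S`, that is, `t` if `v` is the `t`-th smallest element of `S`; it is the
first index of the factor of `x_S` that belongs to `v`. -/
def position (S : Finset ℤ) (v : ℤ) : ℤ := #{u ∈ S | u ≤ v}

theorem monomialx_val (S : Finset ℤ) :
    monomialx 𝕜 S.val = ∏ v ∈ S, indet 𝕜 (position S v) v := by
  induction S using Finset.induction_on_max with
  | empty => simp [monomialx]
  | insert a S lt_a ih =>
    have ha : a ∉ S := fun h => lt_irrefl a (lt_a a h)
    have position_max : position (insert a S) a = 1 + (S.card : ℤ) := by
      rw [position, filter_true_of_mem, card_insert_of_notMem ha]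
      · push_cast
        ring
      · grind
    have position_below (v : ℤ) (hv : v ∈ S) : position (insert a S) v = position S v := by
      rw [position, filter_insert, if_neg (lt_a v hv).not_ge, position]
    rw [insert_val_of_notMem ha, ← Multiset.singleton_add, add_comm,
      monomialx_add 𝕜 (by simpa using fun v hv => (lt_a v hv).le), monomialx_singleton,
      iterate_raise_indet, prod_insert ha, position_max, prod_congr rfl fun v hv => by
        rw [position_below v hv], ih, mul_comm, card_val]

/-- The exponent of the monomial `∏ v ∈ S, x_{f v, v}`, the indicator of the graph of `f` on `S`. -/
def graphExponent (f : ℤ → ℤ) (S : Finset ℤ) : ℤ × ℤ →₀ ℕ :=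
  ∑ v ∈ S, Finsupp.single (f v, v) 1

theorem graphExponent_apply (f : ℤ → ℤ) (S : Finset ℤ) (i v : ℤ) :
    graphExponent f S (i, v) = if v ∈ S ∧ f v = i then 1 else 0 := by
  simp only [graphExponent, Finsupp.finsetSum_apply, Finsupp.single_apply, Prod.mk.injEq]
  rw [← sum_filter, sum_const, smul_eq_mul, mul_one]
  split_ifs with h
  · exact card_eq_one.2 ⟨v, by grind⟩
  · exact card_eq_zero.2 (by grind)

theorem prod_indet (f : ℤ → ℤ) (S : Finset ℤ) :
    ∏ v ∈ S, indet 𝕜 (f v) v = algebraMap (MvPolynomial (ℤ × ℤ) 𝕜) (RatField 𝕜)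
      (monomial (graphExponent f S) 1) := by
  rw [graphExponent, monomial_sum_one, map_prod]
  rfl

/-- The set `S` without its largest element, defined so that no case distinction is needed for
`S = ∅`. -/
def eraseMax (S : Finset ℤ) : Finset ℤ := {v ∈ S | ∃ w ∈ S, v < w}

theorem eraseMax_insert {S : Finset ℤ} {j : ℤ} (h : ∀ v ∈ S, v < j) :
    eraseMax (insert j S) = S := by
  ext v
  have := mem_insert_self j S
  have := h v
  simp only [eraseMax, mem_filter]
  grind

theorem position_eraseMax {S : Finset ℤ} {v : ℤ} (hv : v ∈ eraseMax S) :
    position (eraseMax S) v = position S v := by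
  rw [position, position]
  congr 2
  grind [eraseMax]

/-- The Laurent monomial `X_S / ↑X_{S ∖ max S}`; the `z`-polynomials are sums of these. -/
def segmentMonomial (S : Finset ℤ) : RatField 𝕜 :=
  monomialX 𝕜 S.val / raise 𝕜 (monomialX 𝕜 (eraseMax S).val)

theorem segmentMonomial_eq (S : Finset ℤ) : segmentMonomial 𝕜 S =
    algebraMap (MvPolynomial (ℤ × ℤ) 𝕜) (RatField 𝕜)
        (monomial (2 • graphExponent (position S) S) 1) /
      algebraMap (MvPolynomial (ℤ × ℤ) 𝕜) (RatField 𝕜)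
        (monomial (2 • graphExponent (position S · + 1) (eraseMax S)) 1) := by
  have monomial_two_nsmul (m : ℤ × ℤ →₀ ℕ) :
      (monomial (2 • m) 1 : MvPolynomial (ℤ × ℤ) 𝕜) = monomial m 1 ^ 2 := by
    rw [monomial_pow, one_pow]
  rw [segmentMonomial, monomialX, monomialX, monomialx_val, monomialx_val, map_pow, map_prod,
    monomial_two_nsmul, monomial_two_nsmul, map_pow, map_pow, ← prod_indet, ← prod_indet]
  congr 2
  exact prod_congr rfl fun v hv => by rw [raise_indet, position_eraseMax hv]

theorem subset_of_graphExponent_add_eq {S T : Finset ℤ}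
    (h : graphExponent (position S) S + graphExponent (position T · + 1) (eraseMax T) =
      graphExponent (position T) T + graphExponent (position S · + 1) (eraseMax S)) : S ⊆ T := by
  intro v hv
  have := DFunLike.congr_fun h (position S v, v)
  simp only [Finsupp.add_apply, graphExponent_apply] at this
  grind

theorem linearIndependent_segmentMonomial : LinearIndependent 𝕜 (segmentMonomial 𝕜) := by
  rw [funext (segmentMonomial_eq 𝕜)]
  refine linearIndependent_algebraMap_monomial_div fun S T h => ?_
  rw [← smul_add, ← smul_add] at h
  have h' := nsmul_right_injective two_ne_zero h
  exact (subset_of_graphExponent_add_eq h').antisymm (subset_of_graphExponent_add_eq h'.symm)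

/-- The initial segment of `S ∪ {j}` that ends at `j`; it indexes the term of `j` in `z(S, T)`. -/
def initialSegment (S : Finset ℤ) (j : ℤ) : Finset ℤ := insert j {v ∈ S | v < j}

theorem isGreatest_initialSegment (S : Finset ℤ) (j : ℤ) :
    IsGreatest (initialSegment S j : Set ℤ) j := by
  refine ⟨by simp [initialSegment], fun v hv => ?_⟩
  grind [initialSegment]

theorem initialSegment_injective (S : Finset ℤ) : Function.Injective (initialSegment S) :=
  fun i j h => (isGreatest_initialSegment S i).unique (h ▸ isGreatest_initialSegment S j)

theorem eraseMax_initialSegment (S : Finset ℤ) (j : ℤ) :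
    eraseMax (initialSegment S j) = {v ∈ S | v < j} :=
  eraseMax_insert fun _ hv => (mem_filter.1 hv).2

theorem initialSegment_subset {S : Finset ℤ} {j : ℤ} (hj : j ∈ S) : initialSegment S j ⊆ S :=
  insert_subset hj (filter_subset _ _)

theorem initialSegment_max' {S : Finset ℤ} (hS : S.Nonempty) :
    initialSegment S (S.max' hS) = S := by
  refine (initialSegment_subset (S.max'_mem hS)).antisymm fun v hv => ?_
  simpa [initialSegment, hv] using (S.le_max' v hv).eq_or_lt

theorem monomialX_add_cons_div {S T : Multiset ℤ} {j : ℤ} (hS : ∀ v ∈ S, v ≤ j)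
    (hT : ∀ v ∈ T, j ≤ v) :
    monomialX 𝕜 (S + j ::ₘ T) / raise 𝕜 (monomialX 𝕜 (S + T)) =
      monomialX 𝕜 (j ::ₘ S) / raise 𝕜 (monomialX 𝕜 S) := by
  have monomialx_union : monomialx 𝕜 (S + j ::ₘ T) = monomialx 𝕜 S *
      (raise 𝕜)^[S.card] (indet 𝕜 1 j * raise 𝕜 (monomialx 𝕜 T)) := by
    rw [monomialx_add 𝕜, ← Multiset.singleton_add, monomialx_add 𝕜 (by simpa using hT),
      monomialx_singleton, Multiset.card_singleton, Function.iterate_one]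
    simp only [Multiset.mem_cons]
    rintro v hv w (rfl | hw)
    exacts [hS v hv, (hS v hv).trans (hT w hw)]
  have monomialx_cons : monomialx 𝕜 (j ::ₘ S) =
      monomialx 𝕜 S * (raise 𝕜)^[S.card] (indet 𝕜 1 j) := by
    rw [← Multiset.singleton_add, add_comm, monomialx_add 𝕜 (by simpa using hS),
      monomialx_singleton]
  rw [monomialX, monomialX, monomialX, monomialX, monomialx_union, monomialx_cons,
    monomialx_add 𝕜 fun v hv w hw => (hS v hv).trans (hT w hw)]
  have raise_S_ne_zero : raise 𝕜 (monomialx 𝕜 S) ≠ 0 := (map_ne_zero _).2 (monomialx_ne_zero 𝕜 _)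
  have raise_T_ne_zero : (raise 𝕜 ^ S.card) (raise 𝕜 (monomialx 𝕜 T)) ≠ 0 :=
    (map_ne_zero _).2 ((map_ne_zero _).2 (monomialx_ne_zero 𝕜 _))
  have raise_iterate (y : RatField 𝕜) :
      raise 𝕜 ((raise 𝕜 ^ S.card) y) = (raise 𝕜 ^ S.card) (raise 𝕜 y) :=
    RingHom.congr_fun (Commute.self_pow (raise 𝕜) S.card) y
  simp only [← RingHom.coe_pow, map_mul, map_pow, raise_iterate]
  field_simp

theorem monomialX_cons_div (S : Finset ℤ) (j : ℤ) :
    monomialX 𝕜 (j ::ₘ S.val) / raise 𝕜 (monomialX 𝕜 S.val) =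
      segmentMonomial 𝕜 (initialSegment S j) := by
  have hS : {v ∈ S | v < j}.val + {v ∈ S | ¬ v < j}.val = S.val := by
    rw [filter_val, filter_val, Multiset.filter_add_not]
  have hj : j ∉ {v ∈ S | v < j} := by simp
  rw [segmentMonomial, eraseMax_initialSegment, initialSegment,
    insert_val_of_notMem hj, ← monomialX_add_cons_div 𝕜 (S := {v ∈ S | v < j}.val)
      (T := {v ∈ S | ¬ v < j}.val), Multiset.add_cons, hS]
  · exact fun v hv => (mem_filter.1 hv).2.le
  · exact fun v hv => not_lt.1 (mem_filter.1 hv).2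

end Monomials


section ZPolynomials

variable (𝕜 : Type*) [Field 𝕜]

theorem zPoly_eq_sum_segmentMonomial (S T : Finset ℤ) :
    zPoly 𝕜 S.val T.val = ∑ j ∈ T, segmentMonomial 𝕜 (initialSegment S j) := by
  simp only [← monomialX_cons_div, div_eq_inv_mul, ← mul_sum]
  rw [zPoly, one_div]
  rfl

/-- The coefficients of `z(S, T)` in the family `segmentMonomial`. -/
def segmentChain (S T : Finset ℤ) : Finset ℤ →₀ 𝕜 :=
  ∑ j ∈ T, Finsupp.single (initialSegment S j) 1

theorem segmentChain_apply (S T G : Finset ℤ) :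
    segmentChain 𝕜 S T G = if G ∈ T.image (initialSegment S) then 1 else 0 := by
  rw [segmentChain, ← sum_image (f := fun H => Finsupp.single H (1 : 𝕜))
    (initialSegment_injective S).injOn]
  simp only [Finsupp.finsetSum_apply, Finsupp.single_apply, sum_ite_eq']

theorem linearCombination_segmentChain (S T : Finset ℤ) :
    Finsupp.linearCombination 𝕜 (segmentMonomial 𝕜) (segmentChain 𝕜 S T) =
      zPoly 𝕜 S.val T.val := by
  simp only [segmentChain, map_sum, Finsupp.linearCombination_single, one_smul,
    zPoly_eq_sum_segmentMonomial]

variable {𝕜}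

theorem mem_and_filter_lt_eq_of_zPoly_eq {S T S' T' : Finset ℤ}
    (h : zPoly 𝕜 S.val T.val = zPoly 𝕜 S'.val T'.val) {j : ℤ} (hj : j ∈ T) :
    j ∈ T' ∧ {v ∈ S | v < j} = {v ∈ S' | v < j} := by
  rw [← linearCombination_segmentChain, ← linearCombination_segmentChain] at h
  have coeff_eq := DFunLike.congr_fun (linearIndependent_segmentMonomial 𝕜 h) (initialSegment S j)
  rw [segmentChain_apply, segmentChain_apply, if_pos (mem_image_of_mem _ hj)] at coeff_eq
  have segment_mem : initialSegment S j ∈ T'.image (initialSegment S') :=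
    of_not_not fun h => one_ne_zero (if_neg h ▸ coeff_eq)
  obtain ⟨j', hj', segment_eq⟩ := mem_image.1 segment_mem
  obtain rfl : j' = j :=
    (isGreatest_initialSegment S' j').unique (segment_eq ▸ isGreatest_initialSegment S j)
  refine ⟨hj', ?_⟩
  have := congrArg eraseMax segment_eq
  rwa [eraseMax_initialSegment, eraseMax_initialSegment, eq_comm] at this

theorem sum_segmentChain_apply {𝓕 : Finset (Finset ℤ)} {G : Finset ℤ} (hG : G.Nonempty)
    (h𝓕 : ∀ F ∈ 𝓕, #F = #G) :
    (∑ F ∈ 𝓕, segmentChain 𝕜 F F) G = if G ∈ 𝓕 then 1 else 0 := by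
  have mem_segments (F : Finset ℤ) (hF : F ∈ 𝓕) : G ∈ F.image (initialSegment F) ↔ F = G := by
    refine ⟨fun h => ?_, ?_⟩
    · obtain ⟨j, hj, rfl⟩ := mem_image.1 h
      exact (eq_of_subset_of_card_le (initialSegment_subset hj) (h𝓕 F hF).le).symm
    · rintro rfl
      exact mem_image.2 ⟨F.max' hG, F.max'_mem hG, initialSegment_max' hG⟩
  rw [Finsupp.finsetSum_apply, ← sum_ite_eq' 𝓕 G fun _ => (1 : 𝕜)]
  exact sum_congr rfl fun F hF => by rw [segmentChain_apply, if_congr (mem_segments F hF) rfl rfl]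

theorem eq_of_sum_zPoly_eq {𝓕 𝓖 : Finset (Finset ℤ)} {n : ℕ} (hn : n ≠ 0)
    (h𝓕 : (𝓕 : Set (Finset ℤ)).Sized n) (h𝓖 : (𝓖 : Set (Finset ℤ)).Sized n)
    (h : ∑ F ∈ 𝓕, zPoly 𝕜 F.val F.val = ∑ F ∈ 𝓖, zPoly 𝕜 F.val F.val) : 𝓕 = 𝓖 := by
  simp only [← linearCombination_segmentChain, ← map_sum] at h
  have chain_eq := linearIndependent_segmentMonomial 𝕜 h
  ext G
  by_cases hG : #G = n
  · have nonempty_G : G.Nonempty := card_ne_zero.1 (hG ▸ hn)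
    have coeff_eq := DFunLike.congr_fun chain_eq G
    rw [sum_segmentChain_apply nonempty_G fun F hF => (h𝓕 hF).trans hG.symm,
      sum_segmentChain_apply nonempty_G fun F hF => (h𝓖 hF).trans hG.symm] at coeff_eq
    by_cases G ∈ 𝓕 <;> by_cases G ∈ 𝓖 <;> simp_all
  · exact iff_of_false (fun h => hG (h𝓕 h)) fun h => hG (h𝓖 h)

end ZPolynomials

theorem SimpComplex.mem_level {Δ : SimpComplex} {k : ℕ} {F : Finset ℤ} :
    F ∈ Δ.level k ↔ F ∈ Δ.faces ∧ #F = k :=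
  mem_filter

section Spectra

variable (𝕜 : Type*) [Field 𝕜]

theorem coboundary_eq_transpose (Δ : SimpComplex) (k : ℕ) :
    coboundary 𝕜 Δ k = (boundary 𝕜 Δ k).transpose := by
  ext F G
  rw [Matrix.transpose_apply, boundary, coboundary, ← sum_filter, ← sum_filter]
  refine sum_congr (Finset.ext fun j => ?_) fun j hj => ?_
  · simp only [mem_filter, mem_sdiff]
    constructor
    · rintro ⟨⟨hjF, hjG⟩, hFG⟩
      exact ⟨hjF, by rw [← hFG, erase_insert hjG]⟩
    · rintro ⟨hjF, hFG⟩
      exact ⟨⟨hjF, hFG ▸ notMem_erase j F.1⟩, by rw [← hFG, insert_erase hjF]⟩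
  · obtain ⟨hjF, hFG⟩ := mem_filter.1 hj
    rw [← hFG, insert_erase hjF]

theorem sq_sum_ite_eq_of_injOn {α β R : Type*} [DecidableEq β] [CommSemiring R] {s : Finset α}
    {e : α → β} (he : Set.InjOn e s) (f : α → R) (y : β) :
    (∑ j ∈ s, if e j = y then f j else 0) ^ 2 = ∑ j ∈ s, if e j = y then f j ^ 2 else 0 := by
  by_cases hy : ∃ i ∈ s, e i = y
  · obtain ⟨i, hi, rfl⟩ := hy
    have vanish {g : α → R} (j : α) (hj : j ∈ s) (hji : j ≠ i) :
        (if e j = e i then g j else 0) = 0 := if_neg fun h => hji (he hj hi h)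
    rw [sum_eq_single_of_mem i hi vanish, sum_eq_single_of_mem i hi vanish, if_pos rfl, if_pos rfl]
  · push Not at hy
    rw [sum_eq_zero fun j hj => if_neg (hy j hj), sum_eq_zero fun j hj => if_neg (hy j hj),
      zero_pow two_ne_zero]

theorem sgn_sq {j : ℤ} {F : Finset ℤ} (hj : j ∈ F) : sgn 𝕜 j F ^ 2 = 1 := by
  rw [sgn, if_pos hj, ← pow_mul, mul_comm, pow_mul, neg_one_sq, one_pow]

theorem monomialX_div_erase {F : Finset ℤ} {j : ℤ} (hj : j ∈ F) :
    monomialX 𝕜 F.val / raise 𝕜 (monomialX 𝕜 (F.erase j).val) =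
      segmentMonomial 𝕜 (initialSegment F j) := by
  have cons_erase : j ::ₘ (F.erase j).val = F.val := Multiset.cons_erase hj
  have segment_erase : initialSegment (F.erase j) j = initialSegment F j := by
    ext v
    grind [initialSegment]
  rw [← segment_erase, ← monomialX_cons_div, cons_erase]

theorem boundary_sq (Δ : SimpComplex) (k : ℕ) (G : Δ.level k) (F : Δ.level (k + 1)) :
    boundary 𝕜 Δ k G F ^ 2 = ∑ j ∈ F.1, if F.1.erase j = G.1 then
      (raise 𝕜)^[Δ.size - (k + 1)] (segmentMonomial 𝕜 (initialSegment F.1 j)) else 0 := by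
  rw [boundary, sq_sum_ite_eq_of_injOn (erase_injOn F.1)]
  refine sum_congr rfl fun j hj => ?_
  rw [← monomialX_div_erase 𝕜 hj, mul_pow, sgn_sq 𝕜 hj, one_mul, Function.iterate_succ_apply,
    ← RingHom.coe_pow, map_div₀, div_pow, monomialX, monomialX, map_pow, map_pow, map_pow]

theorem trace_upDownLaplacian (Δ : SimpComplex) (k : ℕ) :
    (upDownLaplacian 𝕜 Δ k).trace =
      (raise 𝕜)^[Δ.size - (k + 1)] (∑ F ∈ Δ.level (k + 1), zPoly 𝕜 F.val F.val) := by
  have erase_mem_level (F : Δ.level (k + 1)) (j : ℤ) (hj : j ∈ F.1) : F.1.erase j ∈ Δ.level k := by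
    obtain ⟨hF, card_F⟩ := SimpComplex.mem_level.1 F.2
    refine SimpComplex.mem_level.2 ⟨Δ.down_closed F.1 hF _ (erase_subset j F.1), ?_⟩
    rw [card_erase_of_mem hj, card_F, Nat.add_sub_cancel]
  calc (upDownLaplacian 𝕜 Δ k).trace
      = ∑ G, ∑ F, boundary 𝕜 Δ k G F ^ 2 := by
        simp only [upDownLaplacian, coboundary_eq_transpose, Matrix.trace, Matrix.diag_apply,
          Matrix.mul_apply, Matrix.transpose_apply, sq]
    _ = ∑ F : Δ.level (k + 1), ∑ j ∈ F.1, ∑ G : Δ.level k, if F.1.erase j = G.1 then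
          (raise 𝕜)^[Δ.size - (k + 1)] (segmentMonomial 𝕜 (initialSegment F.1 j)) else 0 := by
        simp only [boundary_sq]
        rw [sum_comm]
        exact sum_congr rfl fun F _ => sum_comm
    _ = ∑ F : Δ.level (k + 1), ∑ j ∈ F.1,
          (raise 𝕜)^[Δ.size - (k + 1)] (segmentMonomial 𝕜 (initialSegment F.1 j)) :=
        sum_congr rfl fun F _ => sum_congr rfl fun j hj => by
          rw [sum_eq_single_of_mem ⟨_, erase_mem_level F j hj⟩ (mem_univ _) fun G _ hG =>
            if_neg fun h => hG (Subtype.ext h.symm), if_pos rfl]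
    _ = _ := by
        simp only [← RingHom.coe_pow, ← map_sum, ← zPoly_eq_sum_segmentMonomial]
        rw [sum_coe_sort (Δ.level (k + 1)) fun F => zPoly 𝕜 F.val F.val]

theorem sum_spec (Δ : SimpComplex) (k : ℕ) :
    (spec 𝕜 Δ k).sum = algebraMap _ _ (upDownLaplacian 𝕜 Δ k).trace := by
  rw [spec, Polynomial.aroots, ← Matrix.charpoly_map, ← Matrix.trace_eq_sum_roots_charpoly,
    ← AddMonoidHom.map_trace]

theorem SimpComplex.ext_level {Δ Γ : SimpComplex} (size_eq : Δ.size = Γ.size)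
    (level_eq : ∀ k < Δ.size, Δ.level (k + 1) = Γ.level (k + 1)) : Δ = Γ := by
  have mem_faces {Λ : SimpComplex} {k : ℕ} {F : Finset ℤ} (hF : #F = k + 1) :
      F ∈ Λ.faces ↔ k < Λ.size ∧ F ∈ Λ.level (k + 1) := by
    rw [mem_level, and_iff_left hF, iff_and_self]
    exact fun h => Nat.lt_of_succ_le (hF.symm.trans_le (le_sup (f := Finset.card) h))
  ext F
  obtain rfl | hF := F.eq_empty_or_nonempty
  · exact iff_of_true Δ.empty_mem Γ.empty_mem
  · obtain ⟨k, hk⟩ := Nat.exists_eq_succ_of_ne_zero hF.card_ne_zero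
    rw [mem_faces hk, mem_faces hk, ← size_eq]
    exact and_congr_right fun h => by rw [level_eq k h]

variable {𝕜}

theorem level_eq_of_spec_eq {Δ Γ : SimpComplex} (size_eq : Δ.size = Γ.size) {k : ℕ}
    (spec_eq : spec 𝕜 Δ k = spec 𝕜 Γ k) : Δ.level (k + 1) = Γ.level (k + 1) := by
  have trace_eq := congrArg Multiset.sum spec_eq
  rw [sum_spec, sum_spec] at trace_eq
  replace trace_eq := FaithfulSMul.algebraMap_injective (RatField 𝕜) _ trace_eq
  rw [trace_upDownLaplacian, trace_upDownLaplacian, size_eq] at trace_eq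
  exact eq_of_sum_zPoly_eq k.succ_ne_zero (fun F hF => (SimpComplex.mem_level.1 hF).2)
    (fun F hF => (SimpComplex.mem_level.1 hF).2) ((raise 𝕜).injective.iterate _ trace_eq)

theorem eq_of_spectra_eq {Δ Γ : SimpComplex} (h : spectra 𝕜 Δ = spectra 𝕜 Γ) : Δ = Γ := by
  have size_eq : Δ.size = Γ.size := by simpa [spectra] using congrArg List.length h
  refine SimpComplex.ext_level size_eq fun k hk => level_eq_of_spec_eq (𝕜 := 𝕜) size_eq ?_
  simpa [spectra, hk, ← size_eq] using congrArg (·[k]?) h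

end Spectra

section ComponentwiseOrder

theorem CompLE.refl (A : Finset ℤ) : CompLE A A :=
  List.forall₂_refl _

theorem CompLE.card_eq {A B : Finset ℤ} (h : CompLE A B) : #A = #B := by
  simpa using h.length_eq

theorem CompLE.trans {A B C : Finset ℤ} (hAB : CompLE A B) (hBC : CompLE B C) : CompLE A C := by
  obtain ⟨length_AB, le_AB⟩ := List.forall₂_iff_get.1 hAB
  obtain ⟨length_BC, le_BC⟩ := List.forall₂_iff_get.1 hBC
  exact List.forall₂_iff_get.2 ⟨length_AB.trans length_BC, fun i hA hC =>
    (le_AB i hA (length_AB ▸ hA)).trans (le_BC i (length_AB ▸ hA) hC)⟩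

theorem CompLE.antisymm {A B : Finset ℤ} (hAB : CompLE A B) (hBA : CompLE B A) : A = B := by
  obtain ⟨length_eq, le_AB⟩ := List.forall₂_iff_get.1 hAB
  obtain ⟨-, le_BA⟩ := List.forall₂_iff_get.1 hBA
  have sort_eq := List.ext_get length_eq fun i hA hB => (le_AB i hA hB).antisymm (le_BA i hB hA)
  rw [← sort_toFinset A (· ≤ ·), sort_eq, sort_toFinset]

theorem CompLE.exists_le {A B : Finset ℤ} (h : CompLE A B) {a : ℤ} (ha : a ∈ A) :
    ∃ b ∈ B, a ≤ b := by
  obtain ⟨length_eq, le⟩ := List.forall₂_iff_get.1 h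
  obtain ⟨i, rfl⟩ := List.get_of_mem ((mem_sort (· ≤ ·)).2 ha)
  exact ⟨_, (mem_sort (· ≤ ·)).1 (List.get_mem _ ⟨i, length_eq ▸ i.2⟩), le i i.2 _⟩

theorem Covers.compLE {A B : Finset ℤ} (h : Covers A B) : CompLE A B := by
  obtain ⟨a, ha, ha', rfl⟩ := h
  have le_swap (v : ℤ) (hv : v ∈ A) : v ≤ Equiv.swap a (a + 1) v := by
    grind
  have strictMonoOn_swap : StrictMonoOn (Equiv.swap a (a + 1)).toEmbedding A := by
    intro u hu v hv huv
    simp only [Equiv.coe_toEmbedding, Equiv.swap_apply_def]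
    grind
  have map_swap : A.map (Equiv.swap a (a + 1)).toEmbedding = insert (a + 1) (A.erase a) := by
    ext v
    simp only [mem_map_equiv, Equiv.symm_swap, Equiv.swap_apply_def]
    grind
  rw [CompLE, ← map_swap, ← strictMonoOn_swap.map_finsetSort, List.forall₂_map_right_iff,
    List.forall₂_same]
  exact fun v hv => le_swap v ((mem_sort _).1 hv)

theorem SimpComplex.exists_compLE_maximal (Δ : SimpComplex) {G : Finset ℤ} (hG : G ∈ Δ.faces) :
    ∃ F ∈ Δ.faces, CompLE G F ∧ ∀ H ∈ Δ.faces, CompLE F H → H = F := by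
  let _ : Preorder (Finset ℤ) :=
    { le := CompLE
      lt := fun A B => CompLE A B ∧ ¬ CompLE B A
      le_refl := CompLE.refl
      le_trans := fun _ _ _ => CompLE.trans }
  obtain ⟨F, hGF, hF, maximal_F⟩ := Δ.faces.exists_le_maximal hG
  exact ⟨F, hF, hGF, fun H hH hFH => CompLE.antisymm (maximal_F hH hFH) hFH⟩

end ComponentwiseOrder

section LongSignatures

theorem isLeast_initialVertex {𝓕 : Finset (Finset ℤ)} (h : (𝓕.biUnion id).Nonempty) :
    IsLeast (𝓕.biUnion id : Set ℤ) (initialVertex 𝓕) := by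
  rw [initialVertex, ← coe_min' h, WithTop.untopD_coe]
  exact isLeast_min' _ h

theorem initialVertex_le {𝓕 : Finset (Finset ℤ)} {A : Finset ℤ} (hA : A ∈ 𝓕) {v : ℤ}
    (hv : v ∈ A) : initialVertex 𝓕 ≤ v :=
  have mem_vertices : v ∈ 𝓕.biUnion id := mem_biUnion.2 ⟨A, hA, hv⟩
  (isLeast_initialVertex ⟨v, mem_vertices⟩).2 mem_vertices

theorem isGreatest_Icc_initialVertex {𝓕 : Finset (Finset ℤ)} {A : Finset ℤ} (hA : A ∈ 𝓕) {a : ℤ}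
    (ha : a ∈ A) : IsGreatest (Icc (initialVertex 𝓕) a : Set ℤ) a := by
  rw [coe_Icc]
  exact isGreatest_Icc (initialVertex_le hA ha)

theorem IsLongSignature.exists_eq {𝓕 : Finset (Finset ℤ)} {S T : Finset ℤ}
    (h : IsLongSignature 𝓕 S T) : ∃ A ∈ 𝓕, ∃ a ∈ A,
      S = {v ∈ A | v < a} ∧ T = Icc (initialVertex 𝓕) a ∧ IsGreatest (T : Set ℤ) a := by
  obtain ⟨A, B, ⟨hA, -, -⟩, a, ha, hS, rfl⟩ := h
  have haA := (mem_sdiff.1 ha).1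
  exact ⟨A, hA, a, haA, hS, rfl, isGreatest_Icc_initialVertex hA haA⟩

theorem IsLongSignature.subset_Icc {𝓕 : Finset (Finset ℤ)} {S T : Finset ℤ}
    (h : IsLongSignature 𝓕 S T) {p q : ℤ} (h𝓕 : ∀ F ∈ 𝓕, F ⊆ Icc p q) : T ⊆ Icc p q := by
  obtain ⟨A, hA, a, ha, -, rfl, -⟩ := h.exists_eq
  have nonempty_vertices : (𝓕.biUnion id).Nonempty := ⟨a, mem_biUnion.2 ⟨A, hA, ha⟩⟩
  obtain ⟨F, hF, initialVertex_mem⟩ := mem_biUnion.1 (isLeast_initialVertex nonempty_vertices).1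
  exact Icc_subset_Icc (mem_Icc.1 (h𝓕 F hF initialVertex_mem)).1 (mem_Icc.1 (h𝓕 A hA ha)).2

theorem IsLongSignature.eq_of_zPoly_eq {𝕜 : Type*} [Field 𝕜] {𝓕 𝓖 : Finset (Finset ℤ)}
    {S T S' T' : Finset ℤ} (h : IsLongSignature 𝓕 S T) (h' : IsLongSignature 𝓖 S' T')
    (hz : zPoly 𝕜 S.val T.val = zPoly 𝕜 S'.val T'.val) : S = S' ∧ T = T' := by
  obtain rfl : T = T' := Subset.antisymm
    (fun j hj => (mem_and_filter_lt_eq_of_zPoly_eq hz hj).1)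
    fun j hj => (mem_and_filter_lt_eq_of_zPoly_eq hz.symm hj).1
  obtain ⟨A, -, a, -, rfl, -, ha⟩ := h.exists_eq
  obtain ⟨A', -, a', -, rfl, -, ha'⟩ := h'.exists_eq
  obtain rfl := ha.unique ha'
  simpa [filter_filter] using (mem_and_filter_lt_eq_of_zPoly_eq hz ha.1).2

theorem SimpComplex.exists_isLongSignature_of_maximal (Δ : SimpComplex) {F : Finset ℤ}
    (hF : F ∈ Δ.faces) (nonempty_F : F.Nonempty) (maximal_F : ∀ G ∈ Δ.faces, CompLE F G → G = F) :
    ∃ (S T : Finset ℤ) (t : ℤ), IsLongSignature (Δ.level #F) S T ∧ IsGreatest (T : Set ℤ) t ∧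
      F = insert t S := by
  set a := F.max' nonempty_F
  have mem_F : a ∈ F := F.max'_mem nonempty_F
  have succ_notMem : a + 1 ∉ F := fun h => (F.le_max' _ h).not_gt (lt_add_one a)
  have covers : Covers F (insert (a + 1) (F.erase a)) := ⟨a, mem_F, succ_notMem, rfl⟩
  have raised_notMem : insert (a + 1) (F.erase a) ∉ Δ.level #F := fun h =>
    succ_notMem (maximal_F _ (mem_level.1 h).1 covers.compLE ▸ mem_insert_self _ _)
  have F_mem_level : F ∈ Δ.level #F := mem_level.2 ⟨hF, rfl⟩
  refine ⟨{v ∈ F | v < a}, Icc (initialVertex (Δ.level #F)) a, a,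
    ⟨F, _, ⟨F_mem_level, raised_notMem, covers⟩, a, by simp [mem_F], rfl, rfl⟩,
    isGreatest_Icc_initialVertex F_mem_level mem_F, (initialSegment_max' nonempty_F).symm⟩

theorem SimpComplex.mem_faces_iff_exists_isLongSignature {Δ : SimpComplex} (hΔ : Δ.IsShifted)
    {G : Finset ℤ} (nonempty_G : G.Nonempty) :
    G ∈ Δ.faces ↔ ∃ (k : ℕ) (S T : Finset ℤ) (t : ℤ), IsLongSignature (Δ.level k) S T ∧
      IsGreatest (T : Set ℤ) t ∧ G ⊆ T ∧ CompLE G (insert t S) := by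
  constructor
  · intro hG
    obtain ⟨F, hF, hGF, maximal_F⟩ := Δ.exists_compLE_maximal hG
    have nonempty_F : F.Nonempty := card_pos.1 (hGF.card_eq ▸ nonempty_G.card_pos)
    obtain ⟨S, T, t, hST, ht, rfl⟩ := Δ.exists_isLongSignature_of_maximal hF nonempty_F maximal_F
    obtain ⟨A, -, a, -, hS, hT, ha⟩ := hST.exists_eq
    obtain rfl := ht.unique ha
    refine ⟨_, S, T, t, hST, ht, fun v hv => hT ▸ mem_Icc.2 ⟨?_, ?_⟩, hGF⟩
    · exact initialVertex_le (mem_level.2 ⟨hG, hGF.card_eq⟩) hv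
    · obtain ⟨w, hw, hvw⟩ := hGF.exists_le hv
      grind
  · rintro ⟨k, S, T, t, hST, ht, hGT, hG⟩
    obtain ⟨p, q, faces_subset, mem_of_compLE⟩ := hΔ
    have T_subset : T ⊆ Icc p q := hST.subset_Icc fun F hF => faces_subset F (mem_level.1 hF).1
    obtain ⟨A, hA, a, haA, rfl, -, ha⟩ := hST.exists_eq
    obtain rfl := ht.unique ha
    have insert_mem : insert t {v ∈ A | v < t} ∈ Δ.faces :=
      Δ.down_closed A (mem_level.1 hA).1 _ (initialSegment_subset haA)
    exact mem_of_compLE G _ insert_mem (hGT.trans T_subset) hG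

end LongSignatures

end

end FineShifted

open FineShifted in
theorem corollary7p8_general (𝕜 : Type*) [Field 𝕜] :
    (∀ Δ Γ : SimpComplex, spectra 𝕜 Δ = spectra 𝕜 Γ → Δ = Γ) ∧
    (∀ (𝓕 𝓖 : Finset (Finset ℤ)) (S T S' T' : Finset ℤ),
      IsLongSignature 𝓕 S T → IsLongSignature 𝓖 S' T' →
      zPoly 𝕜 S.val T.val = zPoly 𝕜 S'.val T'.val → S = S' ∧ T = T') ∧
    (∀ Δ : SimpComplex, ∀ F ∈ Δ.faces, F.Nonempty → (∀ G ∈ Δ.faces, CompLE F G → G = F) →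
      ∃ (S T : Finset ℤ) (t : ℤ), IsLongSignature (Δ.level F.card) S T ∧
        IsGreatest (T : Set ℤ) t ∧ F = insert t S) ∧
    (∀ Δ : SimpComplex, Δ.IsShifted → ∀ G : Finset ℤ, G.Nonempty →
      (G ∈ Δ.faces ↔ ∃ (k : ℕ) (S T : Finset ℤ) (t : ℤ), IsLongSignature (Δ.level k) S T ∧
        IsGreatest (T : Set ℤ) t ∧ G ⊆ T ∧ CompLE G (insert t S))) :=
  ⟨fun _ _ => eq_of_spectra_eq,
    fun _ _ _ _ _ _ h h' => h.eq_of_zPoly_eq h',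
    fun Δ _ => Δ.exists_isLongSignature_of_maximal,
    fun _ hΔ _ => SimpComplex.mem_faces_iff_exists_isLongSignature hΔ⟩

theorem corollary7p8 (𝕜 : Type*) [Field 𝕜] [CharZero 𝕜] :
    -- a shifted complex is determined by its family of spectra
    (∀ Δ Γ : FineShifted.SimpComplex, Δ.IsShifted → Γ.IsShifted →
      FineShifted.spectra 𝕜 Δ = FineShifted.spectra 𝕜 Γ → Δ = Γ) ∧
    -- the long signature of a critical pair is determined by its z-polynomial
    (∀ (𝓕 𝓖 : Finset (Finset ℤ)) (S T S' T' : Finset ℤ),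
      FineShifted.IsLongSignature 𝓕 S T → FineShifted.IsLongSignature 𝓖 S' T' →
      FineShifted.zPoly 𝕜 S.val T.val = FineShifted.zPoly 𝕜 S'.val T'.val →
      S = S' ∧ T = T') ∧
    -- every nonempty face that is maximal in the componentwise order is read off
    -- as `S ∪ {max T}` from a long signature `(S, T)` in its dimension
    (∀ Δ : FineShifted.SimpComplex, Δ.IsShifted → ∀ F ∈ Δ.faces, F.Nonempty →
      (∀ G ∈ Δ.faces, FineShifted.CompLE F G → G = F) →
      ∃ (S T : Finset ℤ) (t : ℤ), FineShifted.IsLongSignature (Δ.level F.card) S T ∧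
        IsGreatest (T : Set ℤ) t ∧ F = insert t S) ∧
    -- the long signatures recover all nonempty faces
    (∀ Δ : FineShifted.SimpComplex, Δ.IsShifted → ∀ G : Finset ℤ, G.Nonempty →
      (G ∈ Δ.faces ↔ ∃ (k : ℕ) (S T : Finset ℤ) (t : ℤ),
        FineShifted.IsLongSignature (Δ.level k) S T ∧ IsGreatest (T : Set ℤ) t ∧
        G ⊆ T ∧ FineShifted.CompLE G (insert t S))) :=
  have ⟨spectra_determine, zPoly_determines, maximal_face, mem_faces_iff⟩ := corollary7p8_general 𝕜
  ⟨fun Δ Γ _ _ => spectra_determine Δ Γ, zPoly_determines, fun Δ _ => maximal_face Δ, mem_faces_iff⟩
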